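/- Let $\mathcal H$ be a complex Hilbert space and let $S,T$ be bounded linear operators on $\mathcal H$ which are paranormal, i.e. $\|Sx\|^2\le\|S^2x\|\,\|x\|$ and $\|Tx\|^2\le\|T^2x\|\,\|x\|$ for all $x\in\mathcal H$. If $S$ and $T$ both satisfy property $(az)$, then the direct sum $S\oplus T$ on $\mathcal H\oplus\mathcal H$ satisfies property $(az)$; and if $S$ and $T$ both satisfy property $(z)$, then $S\oplus T$ satisfies property $(z)$. Here, for a bounded operator $A$ on a complex Hilbert space with kernel $N(A)$ and range $R(A)$, $\sigma(A)$ is the spectrum; $\sigma_a(A)$ is the approximate point spectrum, the set of $\lambda\in\mathbb C$ for which $A-\lambda I$ is not bounded below; and $\sigma_{uw}(A)$ is the upper semi-Weyl spectrum, the set of $\lambda$ for which it is not true that $A-\lambda I$ has closed range, $\dim N(A-\lambda I)<\infty$ and index $\dim N(A-\lambda I)-\operatorname{codim}R(A-\lambda I)\le 0$. The ascent of $A$ is the least integer $n\ge0$ with $N(A^n)=N(A^{n+1})$ ($\infty$ if there is none). Let $p_{00}^a(A)$ be the set of left poles of finite rank: those $\lambda\in\sigma_a(A)$ such that $A-\lambda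 I$ has finite ascent $p$, $R\big((A-\lambda I)^{p+1}\big)$ is closed, and $\dim N(A-\lambda I)<\infty$. Let $\pi_{00}^a(A)$ be the set of isolated points $\lambda$ of $\sigma_a(A)$ with $0<\dim N(A-\lambda I)<\infty$. Then $A$ satisfies property $(az)$ if $\sigma(A)\setminus\sigma_{uw}(A)=p_{00}^a(A)$, and property $(z)$ if $\sigma(A)\setminus\sigma_{uw}(A)=\pi_{00}^a(A)$. -/

import Mathlib

open scoped Topology

noncomputable section

namespace SpectralProperty

section Operators

variable {X : Type*} [NormedAddCommGroup X] [NormedSpace ℂ X]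

/-- The operator `T - z I`. -/
def shift (T : X →L[ℂ] X) (z : ℂ) : X →L[ℂ] X := T - z • (1 : X →L[ℂ] X)

/-- The kernel `N(T)`. -/
def kernel (T : X →L[ℂ] X) : Submodule ℂ X := LinearMap.ker (T : X →ₗ[ℂ] X)

/-- The range `R(T)`. -/
def range (T : X →L[ℂ] X) : Submodule ℂ X := LinearMap.range (T : X →ₗ[ℂ] X)

/-- The dimension of the kernel, as a natural number or `∞`. -/
def nullity (T : X →L[ℂ] X) : ℕ∞ := Cardinal.toENat (Module.rank ℂ (kernel T))

/-- The codimension of the range, as a natural number or `∞`. -/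
def deficiency (T : X →L[ℂ] X) : ℕ∞ := Cardinal.toENat (Module.rank ℂ (X ⧸ range T))

/-- Closed range and finite-dimensional kernel. -/
def IsUpperSemiFredholm (T : X →L[ℂ] X) : Prop :=
  IsClosed (range T : Set X) ∧ nullity T < ⊤

/-- The index `dim N(T) - codim R(T)`; it is meaningful when `T` is semi-Fredholm, so that at most
one of the two terms is infinite. -/
def index (T : X →L[ℂ] X) : EReal :=
  (((nullity T : ℕ∞) : ENNReal) : EReal) - (((deficiency T : ℕ∞) : ENNReal) : EReal)

/-- Upper semi-Fredholm of index at most zero. -/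
def IsUpperSemiWeyl (T : X →L[ℂ] X) : Prop :=
  IsUpperSemiFredholm T ∧ index T ≤ 0

/-- The upper semi-Weyl spectrum. -/
def upperSemiWeylSpectrum (T : X →L[ℂ] X) : Set ℂ :=
  {z | ¬ IsUpperSemiWeyl (shift T z)}

/-- The approximate (point) spectrum: the `z` for which `T - z I` is not bounded below. -/
def approxSpectrum (T : X →L[ℂ] X) : Set ℂ :=
  {z | ¬ ∃ c : ℝ, 0 < c ∧ ∀ x : X, c * ‖x‖ ≤ ‖shift T z x‖}

/-- The ascent: the least `n ≥ 0` with `N(T ^ n) = N(T ^ (n + 1))`, or `∞` if there is none. -/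
def ascent (T : X →L[ℂ] X) : ℕ∞ :=
  ⨅ (n : ℕ) (_ : kernel (T ^ n) = kernel (T ^ (n + 1))), (n : ℕ∞)

/-- Left poles: points `z` of the approximate spectrum such that `T - z I` has finite ascent `p`
and the range of `(T - z I) ^ (p + 1)` is closed. -/
def leftPoles (T : X →L[ℂ] X) : Set ℂ :=
  {z | z ∈ approxSpectrum T ∧ ∃ p : ℕ, ascent (shift T z) = p ∧
    IsClosed (range (shift T z ^ (p + 1)) : Set X)}

/-- Left poles of finite rank: left poles `z` such that `N(T - z I)` is finite-dimensional. -/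
def leftPolesFiniteRank (T : X →L[ℂ] X) : Set ℂ :=
  {z | z ∈ leftPoles T ∧ nullity (shift T z) < ⊤}

/-- Eigenvalues of finite multiplicity, that is, with a finite-dimensional nonzero eigenspace. -/
def finiteMultEigenvalues (T : X →L[ℂ] X) : Set ℂ :=
  {z | 0 < nullity (shift T z) ∧ nullity (shift T z) < ⊤}

/-- The isolated points of a subset of the plane. -/
def isolatedPoints (A : Set ℂ) : Set ℂ := {z | z ∈ A ∧ ∃ U ∈ 𝓝 z, U ∩ A = {z}}

/-- Isolated points of the approximate spectrum that are eigenvalues of finite multiplicity. -/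
def isolatedApproxFiniteMult (T : X →L[ℂ] X) : Set ℂ :=
  isolatedPoints (approxSpectrum T) ∩ finiteMultEigenvalues T

/-- Property `(az)`. -/
def PropertyAZ (T : X →L[ℂ] X) : Prop :=
  spectrum ℂ T \ upperSemiWeylSpectrum T = leftPolesFiniteRank T

/-- Property `(z)`. -/
def PropertyZ (T : X →L[ℂ] X) : Prop :=
  spectrum ℂ T \ upperSemiWeylSpectrum T = isolatedApproxFiniteMult T

end Operators

section Hilbert

variable {H : Type*} [NormedAddCommGroup H] [InnerProductSpace ℂ H]
variable {K : Type*} [NormedAddCommGroup K] [InnerProductSpace ℂ K]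

/-- Paranormal operators. -/
def IsParanormal (T : H →L[ℂ] H) : Prop :=
  ∀ x : H, ‖T x‖ ^ 2 ≤ ‖T (T x)‖ * ‖x‖

/-- The direct sum `(x, y) ↦ (S x, T y)` on the Hilbert space direct sum of `H` and `K`. -/
def directSum (S : H →L[ℂ] H) (T : K →L[ℂ] K) :
    WithLp 2 (H × K) →L[ℂ] WithLp 2 (H × K) :=
  ((WithLp.prodContinuousLinearEquiv 2 ℂ H K).symm : H × K →L[ℂ] WithLp 2 (H × K)) ∘L
    (S.prodMap T) ∘L
    ((WithLp.prodContinuousLinearEquiv 2 ℂ H K) : WithLp 2 (H × K) →L[ℂ] H × K)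

theorem directSum_apply (S : H →L[ℂ] H) (T : K →L[ℂ] K) (x : H) (y : K) :
    directSum S T (WithLp.toLp 2 (x, y)) = WithLp.toLp 2 (S x, T y) := rfl

end Hilbert

end SpectralProperty

end

/-! Paranormality forces every `T - z` to have ascent at most one. Then `N(T - z)` meets `R(T - z)`
trivially, so the index is at most zero and upper semi-Weyl means upper semi-Fredholm. Ascent at
most one also makes the finite-rank left poles exactly the points of the approximate spectrum where
`T - z` is upper semi-Fredholm.

Hence `(az)` only says that `σ \ σ_uw` lies in `σ_a`. Since a point off `σ_a` is never in `σ_uw`,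
this amounts to `σ_a = σ`. Both spectra of a direct sum are unions, so `(az)` passes to `S ⊕ T`,
although `S ⊕ T` itself need not be paranormal.

Property `(z)` also gives `σ_a = σ`, but one more fact is needed: paranormal operators are isoloid
(`IsParanormal.exists_eigenvector`). An isolated point of `σ_a(S ⊕ T)` with finite nullity is, for
each summand, either off `σ_a` or isolated in `σ_a = σ`. In the first case the shift is bounded
below. In the second the point is an eigenvalue of finite multiplicity, and `(z)` for that summand
makes the shift upper semi-Fredholm.

For isoloidness, let `W` be the range of the Riesz projection at an isolated point `c`. Contour
estimates on powers, combined with log-convexity of `‖S ^ n w‖`, give `‖S w‖ = ‖c‖ ‖w‖` on `W`. For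
`c ≠ 0` this makes `S - c` paranormal on `W`, where it is quasinilpotent, hence zero. -/

namespace SpectralProperty

/-! ### Holomorphic functional calculus at an isolated point of the spectrum. -/

section ResolventIntegral

open Metric

variable {A : Type*} [NormedRing A] [NormedAlgebra ℂ A]

theorem circleIntegral_comp_comm {E F : Type*} [NormedAddCommGroup E] [NormedSpace ℂ E]
    [CompleteSpace E] [NormedAddCommGroup F] [NormedSpace ℂ F] [CompleteSpace F]
    (L : E →L[ℂ] F) {f : ℂ → E} {c : ℂ} {r : ℝ} (hf : CircleIntegrable f c r) :
    ∮ z in C(c, r), L (f z) = L (∮ z in C(c, r), f z) := by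
  simp only [circleIntegral]
  rw [← L.intervalIntegral_comp_comm hf.out]
  simp

/-- The integral of `f` against the resolvent of `a` over a circle. -/
noncomputable def resolventIntegral (a : A) (c : ℂ) (r : ℝ) (f : ℂ → ℂ) : A :=
  ∮ z in C(c, r), f z • resolvent a z

/-- The ball around `c` meets the spectrum of `a` at most in `c`. -/
def PuncturedResolventBall (a : A) (c : ℂ) (R : ℝ) : Prop :=
  ∀ z ∈ ball c R, z ≠ c → z ∈ resolventSet ℂ a

variable {a : A} {c : ℂ} {R : ℝ}

theorem sub_mul_resolvent {z : ℂ} (hz : z ∈ resolventSet ℂ a) :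
    (algebraMap ℂ A z - a) * resolvent a z = 1 :=
  Ring.mul_inverse_cancel _ hz

theorem resolvent_mul_sub {z : ℂ} (hz : z ∈ resolventSet ℂ a) :
    resolvent a z * (algebraMap ℂ A z - a) = 1 :=
  Ring.inverse_mul_cancel _ hz

theorem mul_resolvent {z : ℂ} (hz : z ∈ resolventSet ℂ a) :
    a * resolvent a z = z • resolvent a z - 1 := by
  rw [← sub_mul_resolvent hz, sub_mul, ← Algebra.smul_def]
  abel

theorem resolvent_mul {z : ℂ} (hz : z ∈ resolventSet ℂ a) :
    resolvent a z * a = z • resolvent a z - 1 := by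
  rw [← resolvent_mul_sub hz, mul_sub, ← Algebra.commutes, ← Algebra.smul_def]
  abel

namespace PuncturedResolventBall

theorem sphere_subset (h : PuncturedResolventBall a c R) {r : ℝ} (hr : 0 < r) (hrR : r < R) :
    sphere c r ⊆ resolventSet ℂ a := fun z hz ↦
  h z (by rw [mem_ball, mem_sphere.1 hz]; exact hrR) (ne_of_mem_sphere hz hr.ne')

end PuncturedResolventBall

variable [CompleteSpace A]

theorem continuousOn_resolvent (a : A) : ContinuousOn (resolvent a) (resolventSet ℂ a) :=
  fun _ hz ↦ (spectrum.hasDerivAt_resolvent_const_left hz).continuousAt.continuousWithinAt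

namespace PuncturedResolventBall

theorem circleIntegrable (h : PuncturedResolventBall a c R) {r : ℝ} (hr : 0 < r) (hrR : r < R)
    {f : ℂ → ℂ} (hf : ContinuousOn f (sphere c r)) :
    CircleIntegrable (fun z ↦ f z • resolvent a z) c r :=
  (hf.smul ((continuousOn_resolvent a).mono (h.sphere_subset hr hrR))).circleIntegrable hr.le

/-- Integrate `a R(z) = z R(z) - 1` against `f`. The correction term vanishes by Cauchy's theorem
when `f` is holomorphic inside, but not for `f = (z - c)⁻¹`. -/
theorem mul_resolventIntegral (h : PuncturedResolventBall a c R) {r : ℝ} (hr : 0 < r)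
    (hrR : r < R) {f : ℂ → ℂ} (hf : ContinuousOn f (sphere c r)) :
    a * resolventIntegral a c r f =
      resolventIntegral a c r (fun z ↦ z * f z) - (∮ z in C(c, r), f z) • (1 : A) := by
  have hi := h.circleIntegrable hr hrR hf
  have hi' : CircleIntegrable (fun z ↦ (z * f z) • resolvent a z) c r :=
    h.circleIntegrable hr hrR (continuousOn_id.mul hf)
  have hi1 : CircleIntegrable (fun z ↦ f z • (1 : A)) c r :=
    (hf.smul continuousOn_const).circleIntegrable hr.le
  have := circleIntegral_comp_comm (ContinuousLinearMap.mul ℂ A a) hi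
  simp only [ContinuousLinearMap.mul_apply'] at this
  rw [resolventIntegral, ← this, resolventIntegral, ← circleIntegral.integral_smul_const,
    ← circleIntegral.integral_sub hi' hi1]
  refine circleIntegral.integral_congr hr.le fun z hz ↦ ?_
  simp only [mul_smul_comm, mul_resolvent (h.sphere_subset hr hrR hz), smul_sub, smul_smul]
  simp [mul_comm]

theorem resolventIntegral_sub_center (h : PuncturedResolventBall a c R) {r : ℝ} (hr : 0 < r)
    (hrR : r < R) {f : ℂ → ℂ} (hf : ContinuousOn f (sphere c r)) :
    resolventIntegral a c r (fun z ↦ z * f z) - c • resolventIntegral a c r f =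
      resolventIntegral a c r (fun z ↦ (z - c) * f z) := by
  have hi : CircleIntegrable (fun z ↦ (z * f z) • resolvent a z) c r :=
    h.circleIntegrable hr hrR (continuousOn_id.mul hf)
  have hi' : CircleIntegrable (fun z ↦ c • f z • resolvent a z) c r :=
    by simpa only [smul_smul, Pi.mul_apply] using
      h.circleIntegrable hr hrR (continuousOn_const.mul hf)
  rw [resolventIntegral, resolventIntegral, ← circleIntegral.integral_smul,
    ← circleIntegral.integral_sub hi hi', resolventIntegral]
  simp only [smul_smul, ← sub_smul, ← sub_mul]

theorem resolventIntegral_mul (h : PuncturedResolventBall a c R) {r : ℝ} (hr : 0 < r)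
    (hrR : r < R) {f : ℂ → ℂ} (hf : ContinuousOn f (sphere c r)) :
    resolventIntegral a c r f * a = a * resolventIntegral a c r f := by
  have hi := h.circleIntegrable hr hrR hf
  have h1 := circleIntegral_comp_comm (ContinuousLinearMap.mul ℂ A a) hi
  have h2 := circleIntegral_comp_comm ((ContinuousLinearMap.mul ℂ A).flip a) hi
  simp only [ContinuousLinearMap.mul_apply', ContinuousLinearMap.flip_apply] at h1 h2
  rw [resolventIntegral, ← h1, ← h2]
  refine circleIntegral.integral_congr hr.le fun z hz ↦ ?_
  simp only [mul_smul_comm, smul_mul_assoc, mul_resolvent (h.sphere_subset hr hrR hz),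
    resolvent_mul (h.sphere_subset hr hrR hz)]

theorem mul_resolventIntegral_of_differentiableOn (h : PuncturedResolventBall a c R) {r : ℝ}
    (hr : 0 < r) (hrR : r < R) {f : ℂ → ℂ} (hf : DifferentiableOn ℂ f (ball c R)) :
    a * resolventIntegral a c r f = resolventIntegral a c r (fun z ↦ z * f z) := by
  have hs : closedBall c r ⊆ ball c R := closedBall_subset_ball hrR
  rw [h.mul_resolventIntegral hr hrR (hf.continuousOn.mono (sphere_subset_closedBall.trans hs)),
    Complex.circleIntegral_eq_zero_of_differentiable_on_off_countable hr.le Set.countable_empty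
      (hf.continuousOn.mono hs), zero_smul, sub_zero]
  exact fun z hz ↦ hf.differentiableAt
    (isOpen_ball.mem_nhds (hs (ball_subset_closedBall hz.1)))

theorem pow_mul_resolventIntegral (h : PuncturedResolventBall a c R) {r : ℝ}
    (hr : 0 < r) (hrR : r < R) {f : ℂ → ℂ} (hf : DifferentiableOn ℂ f (ball c R)) (n : ℕ) :
    a ^ n * resolventIntegral a c r f = resolventIntegral a c r (fun z ↦ z ^ n * f z) := by
  induction n with
  | zero => simp
  | succ n ih =>
    rw [pow_succ', mul_assoc, ih, h.mul_resolventIntegral_of_differentiableOn hr hrR (by fun_prop)]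
    simp only [pow_succ', mul_assoc]

theorem sub_pow_mul_resolventIntegral (h : PuncturedResolventBall a c R) {r : ℝ}
    (hr : 0 < r) (hrR : r < R) {f : ℂ → ℂ} (hf : DifferentiableOn ℂ f (ball c R)) (n : ℕ) :
    (a - algebraMap ℂ A c) ^ n * resolventIntegral a c r f =
      resolventIntegral a c r (fun z ↦ (z - c) ^ n * f z) := by
  induction n with
  | zero => simp
  | succ n ih =>
    have hd : DifferentiableOn ℂ (fun z ↦ (z - c) ^ n * f z) (ball c R) := by fun_prop
    have hs : sphere c r ⊆ ball c R := sphere_subset_closedBall.trans (closedBall_subset_ball hrR)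
    have hc := hd.continuousOn.mono hs
    rw [pow_succ', mul_assoc, ih, sub_mul, h.mul_resolventIntegral_of_differentiableOn hr hrR hd,
      ← Algebra.smul_def, h.resolventIntegral_sub_center hr hrR hc]
    simp only [pow_succ', mul_assoc]

theorem resolventIntegral_eq (h : PuncturedResolventBall a c R) {r s : ℝ} (hr : 0 < r)
    (hrs : r ≤ s) (hs : s < R) {f : ℂ → ℂ} (hf : DifferentiableOn ℂ f (ball c R)) :
    resolventIntegral a c s f = resolventIntegral a c r f := by
  have hd : ∀ z ∈ closedBall c s \ ball c r,
      DifferentiableAt ℂ (fun z ↦ f z • resolvent a z) z := by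
    rintro z ⟨hz, hz'⟩
    have hzR := closedBall_subset_ball hs hz
    refine (hf.differentiableAt (isOpen_ball.mem_nhds hzR)).smul
      (spectrum.hasDerivAt_resolvent_const_left (h z hzR ?_)).differentiableAt
    rintro rfl
    exact hz' (mem_ball_self hr)
  exact Complex.circleIntegral_eq_of_differentiable_on_annulus_off_countable hr hrs
    Set.countable_empty (fun z hz ↦ (hd z hz).continuousAt.continuousWithinAt)
    fun z hz ↦ hd z ⟨ball_subset_closedBall hz.1.1, fun hz' ↦ hz.1.2 (ball_subset_closedBall hz')⟩

/-- Deforming the contour lets an integral over a fixed circle be bounded on an arbitrarily small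
one. The constant depends on the radius `r` but not on `f`, so it disappears on taking roots of
powers. -/
theorem exists_norm_resolventIntegral_le (h : PuncturedResolventBall a c R) {r s : ℝ} (hr : 0 < r)
    (hrs : r ≤ s) (hs : s < R) :
    ∃ C : ℝ, 0 ≤ C ∧ ∀ (f : ℂ → ℂ) (K : ℝ), DifferentiableOn ℂ f (ball c R) →
      (∀ z ∈ sphere c r, ‖f z‖ ≤ K) → ‖resolventIntegral a c s f‖ ≤ C * K := by
  obtain ⟨M, hM⟩ := (isCompact_sphere c r).exists_bound_of_continuousOn
    ((continuousOn_resolvent a).mono (h.sphere_subset hr (hrs.trans_lt hs)))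
  have hM0 : 0 ≤ M := (norm_nonneg _).trans
    (hM (c + r) (by simp [abs_of_pos hr]))
  refine ⟨2 * Real.pi * r * M, by positivity, fun f K hf hK ↦ ?_⟩
  rw [h.resolventIntegral_eq hr hrs hs hf, mul_assoc]
  refine circleIntegral.norm_integral_le_of_norm_le_const hr.le fun z hz ↦ ?_
  rw [norm_smul, mul_comm M]
  exact mul_le_mul (hK z hz) (hM z hz) (norm_nonneg _) ((norm_nonneg _).trans (hK z hz))

/-- If the integral vanished, the integral of `(z - c)⁻¹` divided by `2πi` would be a two-sided
inverse of `c - a`. -/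
theorem resolventIntegral_one_ne_zero (h : PuncturedResolventBall a c R) (hc : c ∈ spectrum ℂ a)
    {r : ℝ} (hr : 0 < r) (hrR : r < R) : resolventIntegral a c r (fun _ ↦ 1) ≠ 0 := by
  intro h0
  have hf : ContinuousOn (fun z : ℂ ↦ (z - c)⁻¹) (sphere c r) :=
    ContinuousOn.inv₀ (by fun_prop) fun z hz ↦ sub_ne_zero.2 (ne_of_mem_sphere hz hr.ne')
  have key : (algebraMap ℂ A c - a) * resolventIntegral a c r (fun z ↦ (z - c)⁻¹) =
      (2 * Real.pi * Complex.I : ℂ) • (1 : A) := by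
    rw [sub_mul, h.mul_resolventIntegral hr hrR hf, ← Algebra.smul_def,
      circleIntegral.integral_sub_center_inv _ hr.ne', sub_sub_eq_add_sub, add_sub_right_comm,
      add_eq_right, ← neg_eq_zero, neg_sub, h.resolventIntegral_sub_center hr hrR hf, ← h0]
    refine circleIntegral.integral_congr hr.le fun z hz ↦ ?_
    simp only [mul_inv_cancel₀ (sub_ne_zero.2 (ne_of_mem_sphere hz hr.ne'))]
  have hcomm := h.resolventIntegral_mul hr hrR hf
  have hpi : (2 * Real.pi * Complex.I : ℂ) ≠ 0 := Complex.two_pi_I_ne_zero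
  refine hc (spectrum.mem_resolventSet_of_left_right_inverse
    (b := (2 * Real.pi * Complex.I : ℂ)⁻¹ • resolventIntegral a c r (fun z ↦ (z - c)⁻¹))
    (c := (2 * Real.pi * Complex.I : ℂ)⁻¹ • resolventIntegral a c r (fun z ↦ (z - c)⁻¹)) ?_ ?_)
  · rw [mul_smul_comm, key, smul_smul, inv_mul_cancel₀ hpi, one_smul]
  · rw [smul_mul_assoc, mul_sub, hcomm, ← Algebra.commutes, ← sub_mul, key, smul_smul,
      inv_mul_cancel₀ hpi, one_smul]

end PuncturedResolventBall

end ResolventIntegral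

end SpectralProperty

namespace SpectralProperty

/-! ### Log-convex sequences. -/

section LogConvex

variable {a : ℕ → ℝ}

/-- The ratios `a (k + 1) / a k` are nondecreasing, so each of the first `n + 1` is at least `a 1 /
a 0`. The vanishing case is split off so that a power of `a 1` can be cancelled. -/
theorem pow_succ_le_of_logConvex (h0 : ∀ n, 0 ≤ a n) (h : ∀ n, a (n + 1) ^ 2 ≤ a (n + 2) * a n)
    (n : ℕ) : a 1 ^ (n + 1) ≤ a (n + 1) * a 0 ^ n := by
  induction n generalizing a with
  | zero => simp
  | succ n ih =>
    rcases (h0 1).eq_or_lt with h1 | h1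
    · rw [← h1, zero_pow (by omega)]
      exact mul_nonneg (h0 _) (pow_nonneg (h0 _) _)
    · have ih' := ih (a := fun k ↦ a (k + 1)) (fun k ↦ h0 _) (fun k ↦ h _)
      simp only [zero_add] at ih'
      refine le_of_mul_le_mul_right ?_ (pow_pos h1 n)
      calc a 1 ^ (n + 1 + 1) * a 1 ^ n = (a 1 ^ 2) ^ (n + 1) := by ring
        _ ≤ (a 2 * a 0) ^ (n + 1) := by gcongr; exact h 0
        _ = a 2 ^ (n + 1) * a 0 ^ (n + 1) := mul_pow _ _ _
        _ ≤ a (n + 1 + 1) * a 1 ^ n * a 0 ^ (n + 1) := by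
          gcongr
          exact pow_nonneg (h0 0) _
        _ = _ := by ring

/-- The same monotonicity read from the other end: the first `n` ratios are at most `a (n + 1) / a
n`. -/
theorem pow_succ_le_of_logConvex' (h0 : ∀ n, 0 ≤ a n) (h : ∀ n, a (n + 1) ^ 2 ≤ a (n + 2) * a n)
    (n : ℕ) : a n ^ (n + 1) ≤ a 0 * a (n + 1) ^ n := by
  induction n with
  | zero => simp
  | succ n ih =>
    rcases (h0 (n + 1)).eq_or_lt with h1 | h1
    · rw [← h1, zero_pow (by omega)]
      exact mul_nonneg (h0 _) (pow_nonneg (h0 _) _)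
    · refine le_of_mul_le_mul_right ?_ (pow_pos h1 n)
      calc a (n + 1) ^ (n + 1 + 1) * a (n + 1) ^ n = (a (n + 1) ^ 2) ^ (n + 1) := by ring
        _ ≤ (a (n + 2) * a n) ^ (n + 1) := pow_le_pow_left₀ (sq_nonneg _) (h n) _
        _ = a (n + 2) ^ (n + 1) * a n ^ (n + 1) := mul_pow _ _ _
        _ ≤ a (n + 2) ^ (n + 1) * (a 0 * a (n + 1) ^ n) :=
          mul_le_mul_of_nonneg_left ih (pow_nonneg (h0 _) _)
        _ = _ := by ring

theorem le_of_forall_pow_le_mul_pow {p q C : ℝ} (hq : 0 ≤ q)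
    (h : ∀ n : ℕ, p ^ (n + 1) ≤ C * q ^ (n + 1)) : p ≤ q := by
  by_contra! hpq
  have hp : 0 < p := hq.trans_lt hpq
  have hC : 0 < C := by
    by_contra! hC
    exact ((pow_pos hp 1).trans_le (h 0)).not_ge
      (mul_nonpos_of_nonpos_of_nonneg hC (pow_nonneg hq _))
  have ht : Filter.Tendsto (fun n : ℕ ↦ C * (q / p) ^ (n + 1)) Filter.atTop (𝓝 (C * 0)) :=
    ((tendsto_pow_atTop_nhds_zero_of_lt_one (by positivity) ((div_lt_one hp).2 hpq)).comp
      (Filter.tendsto_add_atTop_nat 1)).const_mul C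
  have : (1 : ℝ) ≤ C * 0 := ge_of_tendsto' ht fun n ↦ by
    rw [div_pow, ← mul_div_assoc, le_div_iff₀ (pow_pos hp _), one_mul]
    exact h n
  norm_num at this

end LogConvex

/-! ### Isolated spectral points of paranormal operators are eigenvalues. -/

section Isoloid

open Metric

variable {H : Type*} [NormedAddCommGroup H] [InnerProductSpace ℂ H]

theorem IsParanormal.logConvex {S : H →L[ℂ] H} (hS : IsParanormal S) (x : H) (n : ℕ) :
    ‖(S ^ (n + 1)) x‖ ^ 2 ≤ ‖(S ^ (n + 2)) x‖ * ‖(S ^ n) x‖ := by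
  have := hS ((S ^ n) x)
  simpa only [pow_succ', mul_apply_eq_comp] using this

/-- If `‖S w‖ = ‖c‖ ‖w‖` on an invariant subspace, then `S - c` is paranormal there. -/
theorem norm_sub_sq_le_of_norm_eq {S : H →L[ℂ] H} {c : ℂ} (hc : c ≠ 0) {W : Submodule ℂ H}
    (hW : ∀ w ∈ W, S w ∈ W) (hn : ∀ w ∈ W, ‖S w‖ = ‖c‖ * ‖w‖) {w : H} (hw : w ∈ W) :
    ‖shift S c w‖ ^ 2 ≤ ‖shift S c (shift S c w)‖ * ‖w‖ := by
  let U : W →ₗᵢ[ℂ] H :=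
    { toLinearMap := (c⁻¹ • (S : H →ₗ[ℂ] H)) ∘ₗ W.subtype
      norm_map' := fun v ↦ by
        simp [norm_smul, hn v v.2, hc] }
  -- Polarization: `c⁻¹ S` is isometric on `W`, so it preserves inner products.
  have hin : ∀ v ∈ W, inner ℂ (S w) (S v) = (starRingEnd ℂ c * c) * inner ℂ w v := by
    intro v hv
    have : inner ℂ (c⁻¹ • S w) (c⁻¹ • S v) = inner ℂ w v :=
      U.inner_map_map ⟨w, hw⟩ ⟨v, hv⟩
    rw [inner_smul_left, inner_smul_right] at this
    rw [← this, map_inv₀]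
    have hc' : starRingEnd ℂ c ≠ 0 := by simpa using hc
    field_simp
  set v := shift S c w with hv
  have hvW : v ∈ W := W.sub_mem (hW w hw) (W.smul_mem c hw)
  have hv' : v = S w - c • w := rfl
  have hvv : shift S c v = S v - c • v := rfl
  -- With `v = (S - c) w`, this identity turns Cauchy–Schwarz and `‖S w‖ = ‖c‖ ‖w‖` into the claim.
  have key : inner ℂ v v = -(c⁻¹ * inner ℂ (S w) (shift S c v)) := by
    rw [hvv, inner_sub_right, hin v hvW, inner_smul_right]
    nth_rewrite 1 [hv']
    rw [inner_sub_left, inner_smul_left]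
    field_simp
    ring
  have h2 : ‖inner ℂ v v‖ = ‖v‖ ^ 2 := by
    rw [inner_self_eq_norm_sq_to_K]; simp
  rw [← h2, key, norm_neg, norm_mul, norm_inv]
  have hc0 : 0 < ‖c‖ := norm_pos_iff.2 hc
  rw [inv_mul_le_iff₀ hc0]
  refine (norm_inner_le_norm _ _).trans (le_of_eq ?_)
  rw [hn w hw]
  ring

variable [CompleteSpace H]

/-- Paranormal operators are isoloid: isolated points of the spectrum are eigenvalues. -/
theorem IsParanormal.exists_eigenvector {S : H →L[ℂ] H} (hS : IsParanormal S) {c : ℂ} {R : ℝ}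
    (hR : 0 < R) (h : PuncturedResolventBall S c R) (hc : c ∈ spectrum ℂ S) :
    ∃ x : H, x ≠ 0 ∧ shift S c x = 0 := by
  -- For `c ≠ 0` the ball is shrunk to avoid `0`, so that negative powers of `z` are holomorphic on
  -- it.
  wlog hcR : c = 0 ∨ R ≤ ‖c‖ generalizing R
  · push Not at hcR
    exact this (norm_pos_iff.2 hcR.1)
      (fun z hz ↦ h z (ball_subset_ball hcR.2.le hz)) (Or.inr le_rfl)
  set Φ : (ℂ → ℂ) → H →L[ℂ] H := resolventIntegral S c (R / 2) with hΦ
  have hr : 0 < R / 2 := half_pos hR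
  have hrR : R / 2 < R := half_lt_self hR
  set E := Φ (fun _ ↦ 1) with hE
  have hE0 : E ≠ 0 := h.resolventIntegral_one_ne_zero hc hr hrR
  have hEc : ∀ x, S (E x) = E (S x) := fun x ↦
    (DFunLike.congr_fun (h.resolventIntegral_mul hr hrR continuousOn_const) x).symm
  set W : Submodule ℂ H := LinearMap.range (E : H →ₗ[ℂ] H) with hWdef
  have hW : ∀ w ∈ W, S w ∈ W := by
    rintro _ ⟨x, rfl⟩
    exact ⟨S x, (hEc x).symm⟩
  have hNW : ∀ w ∈ W, shift S c w ∈ W := fun w hw ↦ W.sub_mem (hW w hw) (W.smul_mem c hw)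
  have upper : ∀ w ∈ W, ‖S w‖ ≤ ‖c‖ * ‖w‖ := by
    rintro _ ⟨x, rfl⟩
    set w := E x with hw
    change ‖S w‖ ≤ ‖c‖ * ‖w‖
    refine le_of_forall_pos_le_add fun ε hε ↦ ?_
    -- Chosen to give `r ‖w‖ ≤ ε`; the `+ 1` covers `w = 0`.
    set r := min (R / 2) (ε / (‖w‖ + 1)) with hrdef
    have hr0 : 0 < r := lt_min hr (by positivity)
    obtain ⟨C, hC, hCb⟩ := h.exists_norm_resolventIntegral_le hr0 (min_le_left _ _) hrR
    have hb : ‖S w‖ ≤ (‖c‖ + r) * ‖w‖ := by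
      refine le_of_forall_pow_le_mul_pow (C := C * ‖x‖ / ‖w‖) (by positivity) fun n ↦ ?_
      rcases eq_or_ne w 0 with h0 | h0
      · simp [h0]
      have h1 := pow_succ_le_of_logConvex (a := fun k ↦ ‖(S ^ k) w‖) (fun _ ↦ norm_nonneg _)
        (hS.logConvex w) n
      have h2 : ‖(S ^ (n + 1)) w‖ ≤ C * (‖c‖ + r) ^ (n + 1) * ‖x‖ := by
        have h3 := h.pow_mul_resolventIntegral hr hrR (f := fun _ ↦ 1)
          (differentiableOn_const _) (n + 1)
        have h4 : (S ^ (n + 1)) w = Φ (fun z ↦ z ^ (n + 1) * 1) x := DFunLike.congr_fun h3 x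
        rw [h4]
        refine (ContinuousLinearMap.le_opNorm _ _).trans ?_
        gcongr
        refine hCb _ _ (by fun_prop) fun z hz ↦ ?_
        rw [mul_one, norm_pow]
        gcongr
        calc ‖z‖ = ‖c + (z - c)‖ := by simp
          _ ≤ ‖c‖ + ‖z - c‖ := norm_add_le _ _
          _ = ‖c‖ + r := by rw [mem_sphere_iff_norm.1 hz]
      simp only [pow_one, pow_zero, one_apply_eq_self] at h1
      have hw0 : 0 < ‖w‖ := norm_pos_iff.2 h0
      calc ‖S w‖ ^ (n + 1) ≤ C * (‖c‖ + r) ^ (n + 1) * ‖x‖ * ‖w‖ ^ n := h1.trans (by gcongr)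
        _ = _ := by rw [mul_pow]; field_simp; ring
    refine hb.trans ?_
    rw [add_mul]
    gcongr
    calc r * ‖w‖ ≤ ε / (‖w‖ + 1) * ‖w‖ := by gcongr; exact min_le_right _ _
      _ ≤ ε := by
        rw [div_mul_eq_mul_div, div_le_iff₀ (by positivity)]
        nlinarith [norm_nonneg w]
  obtain ⟨x, hx⟩ : ∃ x, E x ≠ 0 := by
    by_contra! hall
    exact hE0 (ContinuousLinearMap.ext hall)
  refine ⟨E x, hx, ?_⟩
  -- For `c = 0` the upper bound alone already gives `S w = 0`.
  rcases eq_or_ne c 0 with rfl | hc0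
  · have := upper (E x) ⟨x, rfl⟩
    simpa [shift] using this
  replace hcR : R ≤ ‖c‖ := hcR.resolve_left hc0
  have hcpos : 0 < ‖c‖ := norm_pos_iff.2 hc0
  have hball : ∀ z ∈ ball c R, z ≠ 0 := by
    rintro z hz rfl
    rw [mem_ball_iff_norm, zero_sub, norm_neg] at hz
    exact hz.not_ge hcR
  have lower : ∀ w ∈ W, ‖c‖ * ‖w‖ ≤ ‖S w‖ := by
    rintro _ ⟨x, rfl⟩
    set w := E x with hw
    change ‖c‖ * ‖w‖ ≤ ‖S w‖
    refine le_of_forall_pos_le_add fun ε hε ↦ ?_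
    set r := min (R / 2) (ε / (‖w‖ + 1)) with hrdef
    have hr0 : 0 < r := lt_min hr (by positivity)
    have hrc : 0 < ‖c‖ - r := by linarith [min_le_left (R / 2) (ε / (‖w‖ + 1))]
    obtain ⟨C, hC, hCb⟩ := h.exists_norm_resolventIntegral_le hr0 (min_le_left _ _) hrR
    have hb : ‖w‖ * (‖c‖ - r) ≤ ‖S w‖ := by
      rcases eq_or_ne w 0 with h0 | h0
      · simp [h0]
      have hw0 : 0 < ‖w‖ := norm_pos_iff.2 h0
      refine le_of_forall_pow_le_mul_pow (C := C * ‖x‖ * (‖c‖ - r) / ‖S w‖) (norm_nonneg _)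
        fun n ↦ ?_
      have hd : DifferentiableOn ℂ (fun z : ℂ ↦ (z ^ n)⁻¹) (ball c R) :=
        DifferentiableOn.inv (by fun_prop) fun z hz ↦ pow_ne_zero _ (hball z hz)
      -- An `n`-th preimage of `w` under `S`, of norm at most a constant times `(‖c‖ - r)⁻ⁿ`.
      -- Log-convexity along the orbit of `v` then bounds `‖S w‖` below.
      set v := Φ (fun z ↦ (z ^ n)⁻¹) x with hv
      have hvw : (S ^ n) v = w := by
        have h3 := h.pow_mul_resolventIntegral hr hrR hd n
        have h4 : (S ^ n) v = Φ (fun z ↦ z ^ n * (z ^ n)⁻¹) x := DFunLike.congr_fun h3 x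
        rw [h4, hw, hE]
        congr 1
        refine circleIntegral.integral_congr hr.le fun z hz ↦ ?_
        have hz0 := hball z (closedBall_subset_ball hrR (sphere_subset_closedBall hz))
        simp only [mul_inv_cancel₀ (pow_ne_zero n hz0)]
      have h1 := pow_succ_le_of_logConvex' (a := fun k ↦ ‖(S ^ k) v‖) (fun _ ↦ norm_nonneg _)
        (hS.logConvex v) n
      simp only [pow_succ' S n, mul_apply_eq_comp, hvw, pow_zero,
        one_apply_eq_self] at h1
      have h2 : ‖v‖ ≤ C * ((‖c‖ - r) ^ n)⁻¹ * ‖x‖ := by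
        refine (ContinuousLinearMap.le_opNorm _ _).trans ?_
        gcongr
        refine hCb _ _ hd fun z hz ↦ ?_
        rw [norm_inv, norm_pow]
        gcongr
        have := norm_sub_norm_le c z
        rw [norm_sub_rev, mem_sphere_iff_norm.1 hz] at this
        linarith
      have h5 : ‖w‖ ^ (n + 1) * (‖c‖ - r) ^ n ≤ C * ‖x‖ * ‖S w‖ ^ n := by
        calc ‖w‖ ^ (n + 1) * (‖c‖ - r) ^ n
            ≤ (C * ((‖c‖ - r) ^ n)⁻¹ * ‖x‖ * ‖S w‖ ^ n) * (‖c‖ - r) ^ n := by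
              gcongr
              exact h1.trans (by gcongr)
          _ = _ := by field_simp
      -- Write `w = S u` with `u` the integral of `z⁻¹`; if `S w = 0`, paranormality at `u` forces
      -- `w = 0`.
      have hSw : 0 < ‖S w‖ := by
        refine (norm_nonneg _).lt_of_ne fun h0' ↦ ?_
        have hinv : DifferentiableOn ℂ (fun z : ℂ ↦ z⁻¹) (ball c R) :=
          DifferentiableOn.inv (by fun_prop) hball
        have h7 := h.mul_resolventIntegral_of_differentiableOn hr hrR hinv
        have h8 : S (Φ (fun z ↦ z⁻¹) x) = w := by
          have h4 : S (Φ (fun z ↦ z⁻¹) x) = Φ (fun z ↦ z * z⁻¹) x := DFunLike.congr_fun h7 x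
          rw [h4, hw, hE]
          congr 1
          refine circleIntegral.integral_congr hr.le fun z hz ↦ ?_
          have hz0 := hball z (closedBall_subset_ball hrR (sphere_subset_closedBall hz))
          simp only [mul_inv_cancel₀ hz0]
        have h9 := hS (Φ (fun z ↦ z⁻¹) x)
        rw [h8, ← h0', zero_mul] at h9
        exact h0 (by simpa using h9)
      calc (‖w‖ * (‖c‖ - r)) ^ (n + 1)
          = (‖w‖ ^ (n + 1) * (‖c‖ - r) ^ n) * (‖c‖ - r) := by rw [mul_pow]; ring
        _ ≤ (C * ‖x‖ * ‖S w‖ ^ n) * (‖c‖ - r) := by gcongr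
        _ = _ := by field_simp; ring
    have : r * ‖w‖ ≤ ε := by
      calc r * ‖w‖ ≤ ε / (‖w‖ + 1) * ‖w‖ := by gcongr; exact min_le_right _ _
        _ ≤ ε := by
          rw [div_mul_eq_mul_div, div_le_iff₀ (by positivity)]
          nlinarith [norm_nonneg w]
    linarith
  have hiso : ∀ w ∈ W, ‖S w‖ = ‖c‖ * ‖w‖ := fun w hw ↦ (upper w hw).antisymm (lower w hw)
  set w := E x with hw
  have hNn : ∀ n, (shift S c ^ n) w ∈ W := fun n ↦ by
    induction n with
    | zero => exact ⟨x, rfl⟩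
    | succ n ih => rw [pow_succ', mul_apply_eq_comp]; exact hNW _ ih
  rw [← norm_eq_zero]
  refine le_antisymm (le_of_forall_pos_le_add fun ε hε ↦ ?_) (norm_nonneg _)
  have hw0 : 0 < ‖w‖ := norm_pos_iff.2 hx
  set r := min (R / 2) (ε / ‖w‖) with hrdef
  have hr0 : 0 < r := lt_min hr (by positivity)
  obtain ⟨C, hC, hCb⟩ := h.exists_norm_resolventIntegral_le hr0 (min_le_left _ _) hrR
  -- Now `S - c` has log-convex orbits in `W`, and its `n`-th power on `W` is the integral of `(z -
  -- c) ^ n`, of size `r ^ n` up to a constant.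
  have hb : ‖shift S c w‖ ≤ r * ‖w‖ := by
    refine le_of_forall_pow_le_mul_pow (C := C * ‖x‖ / ‖w‖) (by positivity) fun n ↦ ?_
    have h1 := pow_succ_le_of_logConvex (a := fun k ↦ ‖(shift S c ^ k) w‖)
      (fun _ ↦ norm_nonneg _) (fun k ↦ by
        have := norm_sub_sq_le_of_norm_eq hc0 hW hiso (hNn k)
        simpa only [pow_succ', mul_apply_eq_comp] using this) n
    have h2 : ‖(shift S c ^ (n + 1)) w‖ ≤ C * r ^ (n + 1) * ‖x‖ := by
      have h3 := h.sub_pow_mul_resolventIntegral hr hrR (f := fun _ ↦ 1)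
        (differentiableOn_const _) (n + 1)
      have h4 : (shift S c ^ (n + 1)) w = Φ (fun z ↦ (z - c) ^ (n + 1) * 1) x := by
        rw [Algebra.algebraMap_eq_smul_one] at h3
        exact DFunLike.congr_fun h3 x
      rw [h4]
      refine (ContinuousLinearMap.le_opNorm _ _).trans ?_
      gcongr
      refine hCb _ _ (by fun_prop) fun z hz ↦ ?_
      rw [mul_one, norm_pow, mem_sphere_iff_norm.1 hz]
    simp only [pow_one, pow_zero, one_apply_eq_self] at h1
    calc ‖shift S c w‖ ^ (n + 1) ≤ C * r ^ (n + 1) * ‖x‖ * ‖w‖ ^ n := h1.trans (by gcongr)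
      _ = _ := by rw [mul_pow]; field_simp; ring
  calc ‖shift S c w‖ ≤ r * ‖w‖ := hb
    _ ≤ ε / ‖w‖ * ‖w‖ := by gcongr; exact min_le_right _ _
    _ = 0 + ε := by field_simp; ring

end Isoloid

end SpectralProperty

namespace SpectralProperty

/-! ### Ascent at most one, semi-Fredholm operators and the approximate spectrum. -/

section Banach

variable {X : Type*} [NormedAddCommGroup X] [NormedSpace ℂ X]

theorem nullity_lt_top_iff (A : X →L[ℂ] X) : nullity A < ⊤ ↔ FiniteDimensional ℂ (kernel A) := by
  rw [nullity, Cardinal.toENat_lt_top, Module.rank_lt_aleph0_iff]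

theorem nullity_pos_iff (A : X →L[ℂ] X) : 0 < nullity A ↔ ∃ x, x ≠ 0 ∧ A x = 0 := by
  rw [pos_iff_ne_zero, nullity, Ne, Cardinal.toENat_eq_zero, rank_zero_iff,
    Submodule.subsingleton_iff_eq_bot, Submodule.eq_bot_iff]
  push Not
  exact exists_congr fun x ↦ and_comm

/-- `N(A) = N(A ^ 2)`. -/
def AscentLeOne (A : X →L[ℂ] X) : Prop := ∀ x, A (A x) = 0 → A x = 0

/-- The kernel meets the range trivially, so it embeds in the quotient by the range. -/
theorem AscentLeOne.nullity_le_deficiency {A : X →L[ℂ] X} (hA : AscentLeOne A) :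
    nullity A ≤ deficiency A := by
  refine OrderHomClass.mono Cardinal.toENat
    (LinearMap.rank_le_of_injective ((range A).mkQ ∘ₗ (kernel A).subtype) ?_)
  rw [← LinearMap.ker_eq_bot, LinearMap.ker_eq_bot']
  rintro ⟨x, hx⟩ h
  obtain ⟨y, hy⟩ := (Submodule.Quotient.mk_eq_zero (range A)).1 h
  change A y = x at hy
  have hx' : A x = 0 := hx
  rw [← hy] at hx'
  exact Subtype.ext (hy ▸ hA y hx')

theorem AscentLeOne.index_le {A : X →L[ℂ] X} (hA : AscentLeOne A) : index A ≤ 0 := by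
  have h : (((nullity A : ℕ∞) : ENNReal) : EReal) ≤ (((deficiency A : ℕ∞) : ENNReal) : EReal) := by
    exact_mod_cast hA.nullity_le_deficiency
  exact EReal.sub_nonpos.2 h

theorem AscentLeOne.isUpperSemiWeyl_iff {A : X →L[ℂ] X} (hA : AscentLeOne A) :
    IsUpperSemiWeyl A ↔ IsUpperSemiFredholm A :=
  and_iff_left hA.index_le

theorem isUpperSemiFredholm_of_bound [CompleteSpace X] {A : X →L[ℂ] X} {c : ℝ} (hc : 0 < c)
    (h : ∀ x, c * ‖x‖ ≤ ‖A x‖) : IsUpperSemiFredholm A := by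
  have hinj : ∀ x, A x = 0 → x = 0 := fun x hx ↦ by
    have := h x
    rw [hx, norm_zero] at this
    exact norm_le_zero_iff.1 (nonpos_of_mul_nonpos_right this hc)
  constructor
  · have : AntilipschitzWith (Real.toNNReal c⁻¹) A := A.antilipschitz_of_bound fun x ↦ by
      rw [Real.coe_toNNReal _ (inv_nonneg.2 hc.le), le_inv_mul_iff₀ hc]
      exact h x
    exact this.isClosed_range A.uniformContinuous
  · rw [nullity_lt_top_iff]
    have : kernel A = ⊥ := (Submodule.eq_bot_iff _).2 hinj
    rw [this]
    infer_instance

/-- By the open mapping theorem `A` is a quotient map onto its closed range. The image of `M` is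
therefore closed once its saturation `M + N(A)` is, and `N(A)` is finite-dimensional. -/
theorem isClosed_map_of_isUpperSemiFredholm [CompleteSpace X] {A : X →L[ℂ] X}
    (hA : IsUpperSemiFredholm A) {M : Submodule ℂ X} (hM : IsClosed (M : Set X)) :
    IsClosed (M.map (A : X →ₗ[ℂ] X) : Set X) := by
  have hcl := hA.1
  have := (nullity_lt_top_iff A).1 hA.2
  have : CompleteSpace (range A) := hcl.completeSpace_coe
  let B : X →L[ℂ] range A := A.codRestrict (range A) fun x ↦ ⟨x, rfl⟩
  have hB : Function.Surjective B := by
    rintro ⟨_, x, rfl⟩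
    exact ⟨x, rfl⟩
  have hq : Topology.IsQuotientMap B := (B.isOpenMap hB).isQuotientMap B.continuous hB
  have hpre : B ⁻¹' (B '' (M : Set X)) = ((M ⊔ kernel A : Submodule ℂ X) : Set X) := by
    ext x
    simp only [Set.mem_preimage, Set.mem_image, SetLike.mem_coe, Submodule.mem_sup]
    constructor
    · rintro ⟨m, hm, hmx⟩
      have hmx' : A m = A x := congrArg Subtype.val hmx
      refine ⟨m, hm, x - m, ?_, add_sub_cancel _ _⟩
      change A (x - m) = 0
      rw [map_sub, hmx', sub_self]
    · rintro ⟨m, hm, k, hk, rfl⟩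
      have hk' : A k = 0 := hk
      refine ⟨m, hm, Subtype.ext ?_⟩
      change A m = A (m + k)
      rw [map_add, hk', add_zero]
  have h1 : IsClosed (B '' (M : Set X)) := by
    rw [← hq.isClosed_preimage, hpre]
    exact Submodule.isClosed_sup_finiteDimensional _ _ hM
  have h2 := hcl.isClosedMap_subtype_val _ h1
  rw [Set.image_image] at h2
  exact h2

theorem isClosed_range_pow [CompleteSpace X] {A : X →L[ℂ] X} (hA : IsUpperSemiFredholm A) (n : ℕ) :
    IsClosed (range (A ^ n) : Set X) := by
  induction n with
  | zero =>
    convert isClosed_univ (X := X)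
    exact Set.eq_univ_of_forall fun x ↦ ⟨x, rfl⟩
  | succ n ih =>
    convert isClosed_map_of_isUpperSemiFredholm hA ih
    rw [pow_succ']
    exact LinearMap.range_comp _ _

theorem ascent_le_one {A : X →L[ℂ] X} (hA : AscentLeOne A) : ascent A ≤ 1 := by
  refine iInf₂_le 1 ?_
  ext x
  change (A ^ 1) x = 0 ↔ (A ^ 2) x = 0
  simp only [pow_two, pow_one, mul_apply_eq_comp]
  exact ⟨fun h ↦ by rw [h, map_zero], hA x⟩

theorem mem_spectrum_iff [CompleteSpace X] (T : X →L[ℂ] X) (z : ℂ) :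
    z ∈ spectrum ℂ T ↔ ¬ Function.Bijective (shift T z) := by
  rw [spectrum.mem_iff, ← ContinuousLinearMap.isUnit_iff_bijective, ← IsUnit.neg_iff, neg_sub,
    Algebra.algebraMap_eq_smul_one]
  rfl

theorem approxSpectrum_subset_spectrum [CompleteSpace X] (T : X →L[ℂ] X) :
    approxSpectrum T ⊆ spectrum ℂ T := by
  intro z hz
  rw [mem_spectrum_iff, ← ContinuousLinearMap.isUnit_iff_bijective]
  rintro ⟨u, hu⟩
  refine hz ⟨(‖(↑u⁻¹ : X →L[ℂ] X)‖ + 1)⁻¹, by positivity, fun x ↦ ?_⟩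
  rw [inv_mul_le_iff₀ (by positivity), ← hu]
  have h1 : x = (↑u⁻¹ : X →L[ℂ] X) ((u : X →L[ℂ] X) x) := by
    rw [← mul_apply_eq_comp, Units.inv_mul, one_apply_eq_self]
  calc ‖x‖ = ‖(↑u⁻¹ : X →L[ℂ] X) ((u : X →L[ℂ] X) x)‖ := by rw [← h1]
    _ ≤ ‖(↑u⁻¹ : X →L[ℂ] X)‖ * ‖(u : X →L[ℂ] X) x‖ := ContinuousLinearMap.le_opNorm _ _
    _ ≤ _ := by gcongr; linarith

theorem isOpen_compl_approxSpectrum (T : X →L[ℂ] X) : IsOpen (approxSpectrum T)ᶜ := by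
  rw [Metric.isOpen_iff]
  intro z hz
  obtain ⟨c, hc, h⟩ := not_not.1 hz
  refine ⟨c / 2, half_pos hc, fun w hw ↦ not_not.2 ⟨c / 2, half_pos hc, fun x ↦ ?_⟩⟩
  have h1 : shift T w x = shift T z x - (w - z) • x := by
    simp only [shift, sub_apply, smul_apply,
      one_apply_eq_self, sub_smul]
    abel
  have h2 : ‖(w - z) • x‖ ≤ c / 2 * ‖x‖ := by
    rw [norm_smul]
    gcongr
    exact (mem_ball_iff_norm.1 hw).le
  rw [h1]
  linarith [norm_sub_norm_le (shift T z x) ((w - z) • x), h x]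

/-- If every point of `σ(T) \ σ_uw(T)` is in the approximate spectrum, so is every point of
`σ(T)`. -/
theorem approxSpectrum_eq_spectrum [CompleteSpace X] {T : X →L[ℂ] X}
    (hT : ∀ z, AscentLeOne (shift T z))
    (h : spectrum ℂ T \ upperSemiWeylSpectrum T ⊆ approxSpectrum T) :
    approxSpectrum T = spectrum ℂ T := by
  refine (approxSpectrum_subset_spectrum T).antisymm fun z hz ↦ ?_
  by_contra hza
  -- Off the approximate spectrum the shift is bounded below, hence upper semi-Fredholm, so the
  -- point is outside `σ_uw`.
  refine hza (h ⟨hz, not_not.2 ((hT z).isUpperSemiWeyl_iff.2 ?_)⟩)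
  obtain ⟨c, hc, hb⟩ := not_not.1 hza
  exact isUpperSemiFredholm_of_bound hc hb

end Banach

/-! ### Ascent of paranormal operators and left poles. -/

section Hilbert

variable {H : Type*} [NormedAddCommGroup H] [InnerProductSpace ℂ H]

/-- For `z ≠ 0` and `(T - z)² x = 0`, `T` acts on the line `x + s y` as `z` times the translation `s
↦ s + 1`. Paranormality becomes `q (s + 1) ^ 2 ≤ q (s + 2) * q s` for the quadratic `q s = ‖x + s y‖
^ 2`. This fails for large `s` if `y ≠ 0`, since `log q` is then eventually strictly concave. -/
theorem IsParanormal.ascentLeOne {T : H →L[ℂ] H} (hT : IsParanormal T) (z : ℂ) :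
    AscentLeOne (shift T z) := by
  intro x hx
  rcases eq_or_ne z 0 with rfl | hz
  · simp only [shift, zero_smul, sub_zero] at hx ⊢
    have := hT x
    rw [hx, norm_zero, zero_mul] at this
    simpa using this
  set y := z⁻¹ • shift T z x with hy
  have hTy : T y = z • y := by
    have : shift T z y = 0 := by rw [hy, map_smul, hx, smul_zero]
    exact sub_eq_zero.1 this
  have hTx : T x = z • (x + y) := by
    rw [hy, smul_add, smul_inv_smul₀ hz]
    simp [shift]
  suffices hy0 : y = 0 by
    rw [hy, smul_eq_zero] at hy0
    exact hy0.resolve_left (inv_ne_zero hz)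
  set g : ℝ → ℝ := fun s ↦ ‖x + (s : ℂ) • y‖ with hg
  have hTs : ∀ s : ℝ, T (x + (s : ℂ) • y) = z • (x + ((s + 1 : ℝ) : ℂ) • y) := fun s ↦ by
    rw [map_add, map_smul, hTy, hTx]
    push_cast
    module
  have hz0 : 0 < ‖z‖ := norm_pos_iff.2 hz
  have hconv : ∀ s : ℝ, g (s + 1) ^ 2 ≤ g (s + 1 + 1) * g s := fun s ↦ by
    have := hT (x + (s : ℂ) • y)
    rw [hTs, map_smul, hTs, norm_smul, norm_smul, norm_smul] at this
    have h2 : ‖z‖ ^ 2 * g (s + 1) ^ 2 ≤ ‖z‖ ^ 2 * (g (s + 1 + 1) * g s) := by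
      simp only [hg]
      linarith
    exact le_of_mul_le_mul_left h2 (by positivity)
  set A := ‖x‖ ^ 2
  set B := RCLike.re (inner ℂ x y)
  set D := ‖y‖ ^ 2 with hD
  have hgsq : ∀ s, g s ^ 2 = A + 2 * s * B + s ^ 2 * D := fun s ↦ by
    simp only [hg]
    rw [@norm_add_sq ℂ, inner_smul_right, norm_smul]
    simp only [Complex.norm_real, Real.norm_eq_abs, mul_pow, sq_abs]
    have : RCLike.re ((s : ℂ) * inner ℂ x y) = s * B := by
      simp [B]
    rw [this]
    ring
  have hpoly : ∀ s : ℝ, (A + 2 * (s + 1) * B + (s + 1) ^ 2 * D) ^ 2 ≤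
      (A + 2 * (s + 1 + 1) * B + (s + 1 + 1) ^ 2 * D) * (A + 2 * s * B + s ^ 2 * D) := fun s ↦ by
    rw [← hgsq, ← hgsq, ← hgsq, ← mul_pow]
    exact pow_le_pow_left₀ (sq_nonneg _) (hconv s) 2
  have hq : ∀ s : ℝ, 2 * (B + (s + 1) * D) ^ 2 ≤ 2 * (A * D - B ^ 2) + D ^ 2 := fun s ↦ by
    linear_combination hpoly s
  by_contra hy0
  have hD0 : 0 < D := by positivity
  have hA0 : 0 ≤ A := by positivity
  -- This `s` makes `B + (s + 1) D` equal to `A D + D ^ 2 + 1`, whose square exceeds the bound.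
  have := hq (((A * D + D ^ 2 + 1) - B) / D - 1)
  rw [sub_add_cancel, div_mul_cancel₀ _ hD0.ne', add_sub_cancel] at this
  nlinarith [mul_nonneg hA0 hD0.le, sq_nonneg B, sq_nonneg D]

variable [CompleteSpace H]

/-- The component of a vector orthogonal to the kernel is its shortest preimage, so `A` is bounded
below on `N(A)ᗮ`, which has the same image. -/
theorem isClosed_range_of_preimage_bound {A : H →L[ℂ] H} {C : ℝ}
    (h : ∀ x, ∃ y, A y = A x ∧ ‖y‖ ≤ C * ‖A x‖) : IsClosed (range A : Set H) := by
  set K := kernel A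
  have hK : IsClosed (K : Set H) := A.isClosed_ker
  have : CompleteSpace K := hK.completeSpace_coe
  have hb : ∀ x ∈ Kᗮ, ‖x‖ ≤ C * ‖A x‖ := by
    intro x hx
    obtain ⟨y, hy, hyx⟩ := h x
    refine le_trans ?_ hyx
    have hyx' : y - x ∈ K := by
      change A (y - x) = 0
      rw [map_sub, hy, sub_self]
    have ho : inner ℂ (y - x) x = 0 := hx _ hyx'
    have := norm_add_sq_eq_norm_sq_add_norm_sq_of_inner_eq_zero (y - x) x ho
    rw [sub_add_cancel] at this
    nlinarith [norm_nonneg x, norm_nonneg y, norm_nonneg (y - x)]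
  have hanti : AntilipschitzWith (Real.toNNReal C) (A ∘L Kᗮ.subtypeL) :=
    ContinuousLinearMap.antilipschitz_of_bound _ fun x ↦
      (hb x x.2).trans (mul_le_mul_of_nonneg_right (Real.le_coe_toNNReal C) (norm_nonneg _))
  have hcl := hanti.isClosed_range (A ∘L Kᗮ.subtypeL).uniformContinuous
  convert hcl
  ext y
  constructor
  · rintro ⟨x, rfl⟩
    obtain ⟨k, hk, m, hm, rfl⟩ := K.exists_add_mem_mem_orthogonal x
    have hk' : A k = 0 := hk
    refine ⟨⟨m, hm⟩, ?_⟩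
    change A m = A (k + m)
    rw [map_add, hk', zero_add]
  · rintro ⟨x, rfl⟩
    exact ⟨x, rfl⟩

/-- The open mapping theorem for `A ^ 2` gives `y` with `A² y = A² x` and `‖y‖ ≤ C ‖A² x‖ ≤ C ‖A‖ ‖A
x‖`. Ascent at most one turns the equality into `A y = A x`. -/
theorem AscentLeOne.isClosed_range {A : H →L[ℂ] H} (hA : AscentLeOne A)
    (h : IsClosed (range (A ^ 2) : Set H)) : IsClosed (range A : Set H) := by
  have : CompleteSpace (range (A ^ 2)) := h.completeSpace_coe
  let B : H →L[ℂ] range (A ^ 2) := (A ^ 2).codRestrict (range (A ^ 2)) fun x ↦ ⟨x, rfl⟩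
  have hB : Function.Surjective B := by
    rintro ⟨_, x, rfl⟩
    exact ⟨x, rfl⟩
  obtain ⟨C, hC, hb⟩ := B.exists_preimage_norm_le hB
  refine isClosed_range_of_preimage_bound (C := C * ‖A‖) fun x ↦ ?_
  obtain ⟨y, hy, hyx⟩ := hb (B x)
  have hy' : (A ^ 2) y = (A ^ 2) x := congrArg Subtype.val hy
  have hn : ‖B x‖ = ‖A (A x)‖ := by
    change ‖(A ^ 2) x‖ = _
    rw [pow_two, mul_apply_eq_comp]
  simp only [pow_two, mul_apply_eq_comp] at hy'
  refine ⟨y, ?_, hyx.trans ?_⟩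
  · rw [← sub_eq_zero, ← map_sub]
    exact hA _ (by rw [map_sub, map_sub, hy', sub_self])
  · rw [hn, mul_assoc]
    gcongr
    exact A.le_opNorm _

theorem mem_leftPolesFiniteRank_iff {T : H →L[ℂ] H} {z : ℂ} (hT : AscentLeOne (shift T z)) :
    z ∈ leftPolesFiniteRank T ↔ z ∈ approxSpectrum T ∧ IsUpperSemiFredholm (shift T z) := by
  constructor
  · rintro ⟨⟨hz, p, hp, hcl⟩, hn⟩
    refine ⟨hz, ?_, hn⟩
    have hp1 : p ≤ 1 := by
      have := ascent_le_one hT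
      rw [hp] at this
      exact_mod_cast this
    -- The closed range is `R(A)` for `p = 0` and `R(A ^ 2)` for `p = 1`.
    interval_cases p
    · simpa using hcl
    · exact hT.isClosed_range hcl
  · rintro ⟨hz, hf⟩
    obtain ⟨p, hp⟩ := ENat.ne_top_iff_exists.1
      ((ascent_le_one hT).trans_lt (ENat.natCast_lt_top 1)).ne
    exact ⟨⟨hz, p, hp.symm, isClosed_range_pow hf _⟩, hf.2⟩

/-- The other inclusion in `(az)` is automatic, because the index condition is. -/
theorem propertyAZ_iff {T : H →L[ℂ] H} (hT : ∀ z, AscentLeOne (shift T z)) :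
    PropertyAZ T ↔ spectrum ℂ T \ upperSemiWeylSpectrum T ⊆ approxSpectrum T := by
  constructor
  · intro h z hz
    exact (h ▸ hz : z ∈ leftPolesFiniteRank T).1.1
  · refine fun h ↦ Set.ext fun z ↦ ?_
    rw [mem_leftPolesFiniteRank_iff (hT z)]
    constructor
    · exact fun hz ↦ ⟨h hz, (not_not.1 hz.2).1⟩
    · exact fun hz ↦ ⟨approxSpectrum_subset_spectrum T hz.1,
        not_not.2 ((hT z).isUpperSemiWeyl_iff.2 hz.2)⟩

end Hilbert

end SpectralProperty

namespace SpectralProperty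

/-! ### Kernels, ranges and approximate spectra of direct sums. -/

section DirectSum

variable {H : Type*} [NormedAddCommGroup H] [InnerProductSpace ℂ H]
variable {K : Type*} [NormedAddCommGroup K] [InnerProductSpace ℂ K]

theorem shift_directSum (S : H →L[ℂ] H) (T : K →L[ℂ] K) (z : ℂ) :
    shift (directSum S T) z = directSum (shift S z) (shift T z) := rfl

theorem directSum_apply_eq_zero_iff (S : H →L[ℂ] H) (T : K →L[ℂ] K) (x : H) (y : K) :
    directSum S T (WithLp.toLp 2 (x, y)) = 0 ↔ S x = 0 ∧ T y = 0 := by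
  rw [directSum_apply, WithLp.toLp_eq_zero, Prod.mk_eq_zero]

theorem AscentLeOne.directSum {S : H →L[ℂ] H} {T : K →L[ℂ] K} (hS : AscentLeOne S)
    (hT : AscentLeOne T) : AscentLeOne (directSum S T) := by
  rintro ⟨x, y⟩ h
  replace h := (directSum_apply_eq_zero_iff S T (S x) (T y)).1 h
  exact (directSum_apply_eq_zero_iff S T x y).2 ⟨hS x h.1, hT y h.2⟩

theorem ascentLeOne_shift_directSum {S : H →L[ℂ] H} {T : K →L[ℂ] K} {z : ℂ}
    (hS : AscentLeOne (shift S z)) (hT : AscentLeOne (shift T z)) :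
    AscentLeOne (shift (directSum S T) z) := hS.directSum hT

theorem bijective_directSum_iff (S : H →L[ℂ] H) (T : K →L[ℂ] K) :
    Function.Bijective (directSum S T) ↔ Function.Bijective S ∧ Function.Bijective T := by
  rw [← Prod.map_bijective]
  change Function.Bijective
    ((WithLp.equiv 2 (H × K)).symm ∘ Prod.map S T ∘ WithLp.equiv 2 (H × K)) ↔ _
  rw [Equiv.comp_bijective, Equiv.bijective_comp]

theorem mem_range_directSum (S : H →L[ℂ] H) (T : K →L[ℂ] K) (x : H) (y : K) :
    WithLp.toLp 2 (x, y) ∈ range (directSum S T) ↔ x ∈ range S ∧ y ∈ range T := by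
  constructor
  · rintro ⟨⟨u, v⟩, h⟩
    have h' := congrArg WithLp.ofLp h
    exact ⟨⟨u, congrArg Prod.fst h'⟩, ⟨v, congrArg Prod.snd h'⟩⟩
  · rintro ⟨⟨u, rfl⟩, ⟨v, rfl⟩⟩
    exact ⟨WithLp.toLp 2 (u, v), rfl⟩

theorem isClosed_range_directSum_iff (S : H →L[ℂ] H) (T : K →L[ℂ] K) :
    IsClosed (range (directSum S T) : Set (WithLp 2 (H × K))) ↔
      IsClosed (range S : Set H) ∧ IsClosed (range T : Set K) := by
  have hc : Continuous (WithLp.toLp 2 : H × K → WithLp 2 (H × K)) :=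
    (WithLp.prodContinuousLinearEquiv 2 ℂ H K).symm.continuous
  have hc' : Continuous (WithLp.ofLp : WithLp 2 (H × K) → H × K) :=
    (WithLp.prodContinuousLinearEquiv 2 ℂ H K).continuous
  constructor
  · intro h
    constructor
    · convert h.preimage (hc.comp (Continuous.prodMk_left (0 : K)))
      ext x
      exact ((mem_range_directSum S T x 0).trans (and_iff_left (zero_mem _))).symm
    · convert h.preimage (hc.comp (Continuous.prodMk_right (0 : H)))
      ext y
      exact ((mem_range_directSum S T 0 y).trans (and_iff_right (zero_mem _))).symm
  · rintro ⟨h1, h2⟩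
    convert (h1.prod h2).preimage hc'
    ext ⟨x, y⟩
    exact mem_range_directSum S T x y

theorem nullity_directSum_lt_top_iff (S : H →L[ℂ] H) (T : K →L[ℂ] K) :
    nullity (directSum S T) < ⊤ ↔ nullity S < ⊤ ∧ nullity T < ⊤ := by
  simp only [nullity_lt_top_iff]
  let e := WithLp.linearEquiv 2 ℂ (H × K)
  have hk : kernel (directSum S T) =
      ((kernel S).prod (kernel T)).map (e.symm : H × K →ₗ[ℂ] WithLp 2 (H × K)) := by
    ext ⟨x, y⟩
    rw [Submodule.mem_map_equiv]
    exact directSum_apply_eq_zero_iff S T x y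
  have h1 : kernel S =
      (kernel (directSum S T)).map (LinearMap.fst ℂ H K ∘ₗ (e : WithLp 2 (H × K) →ₗ[ℂ] H × K)) := by
    ext x
    constructor
    · exact fun hx ↦ ⟨WithLp.toLp 2 (x, 0),
        (directSum_apply_eq_zero_iff S T x 0).2 ⟨hx, map_zero _⟩, rfl⟩
    · rintro ⟨⟨u, v⟩, h, rfl⟩
      exact ((directSum_apply_eq_zero_iff S T u v).1 h).1
  have h2 : kernel T =
      (kernel (directSum S T)).map (LinearMap.snd ℂ H K ∘ₗ (e : WithLp 2 (H × K) →ₗ[ℂ] H × K)) := by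
    ext y
    constructor
    · exact fun hy ↦ ⟨WithLp.toLp 2 (0, y),
        (directSum_apply_eq_zero_iff S T 0 y).2 ⟨map_zero _, hy⟩, rfl⟩
    · rintro ⟨⟨u, v⟩, h, rfl⟩
      exact ((directSum_apply_eq_zero_iff S T u v).1 h).2
  simp only [FiniteDimensional, Module.Finite.iff_fg]
  constructor
  · intro h
    rw [h1, h2]
    exact ⟨h.map _, h.map _⟩
  · rintro ⟨hS, hT⟩
    rw [hk]
    exact (hS.prod hT).map _

theorem isUpperSemiFredholm_directSum_iff (S : H →L[ℂ] H) (T : K →L[ℂ] K) :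
    IsUpperSemiFredholm (directSum S T) ↔ IsUpperSemiFredholm S ∧ IsUpperSemiFredholm T := by
  simp only [IsUpperSemiFredholm, isClosed_range_directSum_iff, nullity_directSum_lt_top_iff]
  tauto

theorem nullity_directSum_pos_iff (S : H →L[ℂ] H) (T : K →L[ℂ] K) :
    0 < nullity (directSum S T) ↔ 0 < nullity S ∨ 0 < nullity T := by
  simp only [nullity_pos_iff]
  constructor
  · rintro ⟨⟨x, y⟩, h0, h⟩
    rw [directSum_apply_eq_zero_iff] at h
    by_cases hx : x = 0
    · exact Or.inr ⟨y, fun hy ↦ h0 ((WithLp.toLp_eq_zero 2).2 (Prod.mk_eq_zero.2 ⟨hx, hy⟩)), h.2⟩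
    · exact Or.inl ⟨x, hx, h.1⟩
  · rintro (⟨x, hx, h⟩ | ⟨y, hy, h⟩)
    · exact ⟨WithLp.toLp 2 (x, 0), fun h' ↦ hx (Prod.mk_eq_zero.1 ((WithLp.toLp_eq_zero 2).1 h')).1,
        (directSum_apply_eq_zero_iff S T x 0).2 ⟨h, map_zero _⟩⟩
    · exact ⟨WithLp.toLp 2 (0, y), fun h' ↦ hy (Prod.mk_eq_zero.1 ((WithLp.toLp_eq_zero 2).1 h')).2,
        (directSum_apply_eq_zero_iff S T 0 y).2 ⟨map_zero _, h⟩⟩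

theorem approxSpectrum_directSum (S : H →L[ℂ] H) (T : K →L[ℂ] K) :
    approxSpectrum (directSum S T) = approxSpectrum S ∪ approxSpectrum T := by
  rw [← compl_inj_iff, Set.compl_union]
  ext z
  simp only [approxSpectrum, Set.mem_compl_iff, Set.mem_inter_iff, Set.mem_ofPred_eq, not_not,
    shift_directSum]
  have hsq : ∀ (x : H) (y : K), ‖WithLp.toLp 2 (x, y)‖ ^ 2 = ‖x‖ ^ 2 + ‖y‖ ^ 2 := fun x y ↦
    WithLp.prod_norm_sq_eq_of_L2 _
  constructor
  · rintro ⟨c, hc, h⟩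
    refine ⟨⟨c, hc, fun x ↦ ?_⟩, ⟨c, hc, fun y ↦ ?_⟩⟩
    · have := h (WithLp.toLp 2 (x, 0))
      rw [directSum_apply, map_zero] at this
      simpa using this
    · have := h (WithLp.toLp 2 (0, y))
      rw [directSum_apply, map_zero] at this
      simpa using this
  · rintro ⟨⟨c, hc, h⟩, ⟨d, hd, h'⟩⟩
    refine ⟨min c d, lt_min hc hd, ?_⟩
    rintro ⟨x, y⟩
    rw [directSum_apply]
    have hm : 0 ≤ min c d := (lt_min hc hd).le
    rw [← pow_le_pow_iff_left₀ (by positivity) (norm_nonneg _) two_ne_zero, mul_pow, hsq, hsq,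
      mul_add, ← mul_pow, ← mul_pow]
    gcongr
    · exact (mul_le_mul_of_nonneg_right (min_le_left c d) (norm_nonneg x)).trans (h x)
    · exact (mul_le_mul_of_nonneg_right (min_le_right c d) (norm_nonneg y)).trans (h' y)

end DirectSum

/-! ### Transfer of the two properties to the direct sum. -/

section Main

variable {H : Type*} [NormedAddCommGroup H] [InnerProductSpace ℂ H]
variable {K : Type*} [NormedAddCommGroup K] [InnerProductSpace ℂ K]

theorem mem_upperSemiWeylSpectrum_iff {T : H →L[ℂ] H} {z : ℂ} (hT : AscentLeOne (shift T z)) :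
    z ∈ upperSemiWeylSpectrum T ↔ ¬ IsUpperSemiFredholm (shift T z) :=
  not_congr hT.isUpperSemiWeyl_iff

theorem isolatedPoints_subset {A B : Set ℂ} (h : A ⊆ B) {z : ℂ} (hz : z ∈ isolatedPoints B)
    (hzA : z ∈ A) : z ∈ isolatedPoints A := by
  obtain ⟨-, U, hU, hUB⟩ := hz
  refine ⟨hzA, U, hU, Set.Subset.antisymm ?_ ?_⟩
  · exact (Set.inter_subset_inter_right U h).trans hUB.subset
  · exact Set.singleton_subset_iff.2 ⟨mem_of_mem_nhds hU, hzA⟩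

theorem isolatedPoints_iff {A : Set ℂ} {z : ℂ} :
    z ∈ isolatedPoints A ↔ z ∈ A ∧ ∀ᶠ w in 𝓝 z, w ∈ A → w = z := by
  refine and_congr_right fun hzA ↦ ?_
  rw [Filter.eventually_iff_exists_mem]
  refine exists_congr fun U ↦ and_congr_right fun hU ↦ ?_
  constructor
  · exact fun h w hw hwA ↦ h.subset ⟨hw, hwA⟩
  · exact fun h ↦ Set.Subset.antisymm (fun w hw ↦ h w hw.1 hw.2)
      (Set.singleton_subset_iff.2 ⟨mem_of_mem_nhds hU, hzA⟩)

/-- Stated conditionally because a point of the union of two spectra may lie in only one; off the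
other, closedness of `σ_a` suffices. -/
theorem eventually_eq_of_mem_approxSpectrum {T : H →L[ℂ] H} {z : ℂ}
    (h : z ∈ approxSpectrum T → z ∈ isolatedPoints (approxSpectrum T)) :
    ∀ᶠ w in 𝓝 z, w ∈ approxSpectrum T → w = z := by
  by_cases hz : z ∈ approxSpectrum T
  · exact (isolatedPoints_iff.1 (h hz)).2
  · filter_upwards [(isOpen_compl_approxSpectrum T).mem_nhds hz] with w hw hw'
    exact absurd hw' hw

theorem upperSemiWeylSpectrum_directSum {S : H →L[ℂ] H} {T : K →L[ℂ] K}
    (hS : ∀ z, AscentLeOne (shift S z)) (hT : ∀ z, AscentLeOne (shift T z)) :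
    upperSemiWeylSpectrum (directSum S T) = upperSemiWeylSpectrum S ∪ upperSemiWeylSpectrum T := by
  ext z
  rw [Set.mem_union, mem_upperSemiWeylSpectrum_iff (hS z), mem_upperSemiWeylSpectrum_iff (hT z),
    mem_upperSemiWeylSpectrum_iff (T := directSum S T) (ascentLeOne_shift_directSum (hS z) (hT z)),
    shift_directSum, isUpperSemiFredholm_directSum_iff, not_and_or]

variable [CompleteSpace H] [CompleteSpace K]

theorem spectrum_directSum (S : H →L[ℂ] H) (T : K →L[ℂ] K) :
    spectrum ℂ (directSum S T) = spectrum ℂ S ∪ spectrum ℂ T := by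
  ext z
  rw [Set.mem_union, mem_spectrum_iff, mem_spectrum_iff, mem_spectrum_iff, shift_directSum,
    bijective_directSum_iff, not_and_or]

theorem propertyAZ_directSum {S : H →L[ℂ] H} {T : K →L[ℂ] K}
    (hS : ∀ z, AscentLeOne (shift S z)) (hT : ∀ z, AscentLeOne (shift T z))
    (h : PropertyAZ S) (h' : PropertyAZ T) : PropertyAZ (directSum S T) := by
  rw [propertyAZ_iff (T := directSum S T) fun z ↦ ascentLeOne_shift_directSum (hS z) (hT z),
    spectrum_directSum, approxSpectrum_directSum, ← approxSpectrum_eq_spectrum hS ((propertyAZ_iff hS).1 h),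
    ← approxSpectrum_eq_spectrum hT ((propertyAZ_iff hT).1 h')]
  exact Set.sdiff_subset

theorem PropertyZ.approxSpectrum_eq {T : H →L[ℂ] H} (hT : ∀ z, AscentLeOne (shift T z))
    (h : PropertyZ T) : approxSpectrum T = spectrum ℂ T :=
  approxSpectrum_eq_spectrum hT fun z hz ↦
    (h ▸ hz : z ∈ isolatedApproxFiniteMult T).1.1

/-- This is where isoloidness enters: it supplies the nonzero kernel required for membership in
`π_00^a`, after which `(z)` applies. -/
theorem IsParanormal.isUpperSemiFredholm_of_isolated {T : H →L[ℂ] H} (hT : IsParanormal T)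
    (h : PropertyZ T) {z : ℂ}
    (hz : z ∈ approxSpectrum T → z ∈ isolatedPoints (approxSpectrum T))
    (hn : nullity (shift T z) < ⊤) : IsUpperSemiFredholm (shift T z) := by
  by_cases hza : z ∈ approxSpectrum T
  · have hiso := hz hza
    have hs := h.approxSpectrum_eq hT.ascentLeOne
    obtain ⟨R, hR, hball⟩ := Metric.eventually_nhds_iff.1 (isolatedPoints_iff.1 hiso).2
    -- Isolation in `σ_a` is isolation in `σ`, because `(z)` makes the two equal.
    have hP : PuncturedResolventBall T z R := fun w hw hwz ↦ by
      by_contra hw'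
      exact hwz (hball hw (hs ▸ hw'))
    have hpos : 0 < nullity (shift T z) :=
      (nullity_pos_iff _).2 (hT.exists_eigenvector hR hP (hs ▸ hza))
    have hmem : z ∈ isolatedApproxFiniteMult T := ⟨hiso, hpos, hn⟩
    rw [← h] at hmem
    exact (not_not.1 hmem.2).1
  · obtain ⟨c, hc, hb⟩ := not_not.1 hza
    exact isUpperSemiFredholm_of_bound hc hb

theorem propertyZ_directSum {S : H →L[ℂ] H} {T : K →L[ℂ] K} (hS : IsParanormal S)
    (hT : IsParanormal T) (h : PropertyZ S) (h' : PropertyZ T) : PropertyZ (directSum S T) := by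
  have hsS := h.approxSpectrum_eq hS.ascentLeOne
  have hsT := h'.approxSpectrum_eq hT.ascentLeOne
  ext z
  rw [spectrum_directSum, upperSemiWeylSpectrum_directSum hS.ascentLeOne hT.ascentLeOne]
  constructor
  · rintro ⟨hz, hzw⟩
    rw [Set.mem_union, not_or] at hzw
    have hfS := (not_not.1 hzw.1).1
    have hfT := (not_not.1 hzw.2).1
    have hiS : z ∈ spectrum ℂ S → z ∈ isolatedApproxFiniteMult S := fun hz ↦
      h ▸ (⟨hz, hzw.1⟩ : z ∈ spectrum ℂ S \ upperSemiWeylSpectrum S)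
    have hiT : z ∈ spectrum ℂ T → z ∈ isolatedApproxFiniteMult T := fun hz ↦
      h' ▸ (⟨hz, hzw.2⟩ : z ∈ spectrum ℂ T \ upperSemiWeylSpectrum T)
    refine ⟨isolatedPoints_iff.2 ⟨?_, ?_⟩, ?_, ?_⟩
    · rwa [approxSpectrum_directSum, hsS, hsT]
    · rw [approxSpectrum_directSum]
      filter_upwards [eventually_eq_of_mem_approxSpectrum fun hz ↦ (hiS (hsS ▸ hz)).1,
        eventually_eq_of_mem_approxSpectrum fun hz ↦ (hiT (hsT ▸ hz)).1] with w h1 h2 hw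
      exact hw.elim h1 h2
    · rw [shift_directSum, nullity_directSum_pos_iff]
      exact hz.imp (fun hz ↦ (hiS hz).2.1) fun hz ↦ (hiT hz).2.1
    · rw [shift_directSum, nullity_directSum_lt_top_iff]
      exact ⟨hfS.2, hfT.2⟩
  · rintro ⟨hiso, -, hn⟩
    rw [approxSpectrum_directSum] at hiso
    rw [shift_directSum, nullity_directSum_lt_top_iff] at hn
    refine ⟨by simpa only [hsS, hsT] using hiso.1, ?_⟩
    rw [Set.mem_union, mem_upperSemiWeylSpectrum_iff (hS.ascentLeOne z),
      mem_upperSemiWeylSpectrum_iff (hT.ascentLeOne z), not_or, not_not, not_not]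
    exact ⟨hS.isUpperSemiFredholm_of_isolated h
        (isolatedPoints_subset Set.subset_union_left hiso) hn.1,
      hT.isUpperSemiFredholm_of_isolated h'
        (isolatedPoints_subset Set.subset_union_right hiso) hn.2⟩

end Main

end SpectralProperty

theorem proposition4p3 {H : Type*} [NormedAddCommGroup H] [InnerProductSpace ℂ H]
    [CompleteSpace H] (S T : H →L[ℂ] H)
    (hS : SpectralProperty.IsParanormal S) (hT : SpectralProperty.IsParanormal T) :
    (SpectralProperty.PropertyAZ S → SpectralProperty.PropertyAZ T →
      SpectralProperty.PropertyAZ (SpectralProperty.directSum S T)) ∧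
    (SpectralProperty.PropertyZ S → SpectralProperty.PropertyZ T →
      SpectralProperty.PropertyZ (SpectralProperty.directSum S T)) :=
  ⟨SpectralProperty.propertyAZ_directSum hS.ascentLeOne hT.ascentLeOne,
    SpectralProperty.propertyZ_directSum hS hT⟩
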